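/- Let $M=(V,D,B)$ be a mixed graph on $V=\{0,1,\dots,n\}$ that is tree-shaped, i.e. the directed edges $D$ form a directed tree with root $0$, and $B$ is an arbitrary set of bidirected edges (unordered pairs of distinct nodes). Let $\Lambda=(\lambda_{i,j})$ have an indeterminate $\lambda_{i,j}$ for every $i\to j$ in $D$ and zeros elsewhere. Let $\Omega=(\omega_{i,j})$ be symmetric, with an indeterminate $\omega_{i,j}=\omega_{j,i}$ whenever $i=j$ or $i\leftrightarrow j$ is in $B$, and zeros elsewhere. Let $\Sigma=(\sigma_{i,j})=(I-\Lambda)^{-T}\,\Omega\,(I-\Lambda)^{-1}$ be the covariance matrix of $V_i=\sum_j\lambda_{j,i}V_j+\epsilon_i$; its entries are polynomials in the indeterminates with real coefficients. Let $K$ be the field of rational functions over $\mathbb{R}$ in these indeterminates. A pair $i\leftrightarrow j$ of distinct nodes not in $B$ is called a missing edge, and the missing edge graph is $(V,\bar B)$. For a missing edge $i\leftrightarrow j$ with $i,j\neq 0$, let $p$ and $q$ be the parents of $i$ and $j$. Its rank is the rank over $K$ of $$\begin{pmatrix}\sigma_{p,q}&\sigma_{i,q}\\ \sigma_{p,j}&\sigma_{i,j}\end{pmatrix},$$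 and its equation, in unknowns $x$ (for $\lambda_{p,i}$) and $y$ (for $\lambda_{q,j}$), is $$x\,y\,\sigma_{p,q}-x\,\sigma_{p,j}-y\,\sigma_{i,q}+\sigma_{i,j}=0 .$$ 1. If $k\ne0$ has parent $r$ and $0\leftrightarrow k$ is missing, then $\sigma_{0,r}\neq0$ and $\lambda_{r,k}=\sigma_{0,k}/\sigma_{0,r}$ in $K$. Call the right-hand side the identifying expression of $k$. 2. Let $i\leftrightarrow j$ be a missing edge of rank $1$ with $i,j\neq0$. Then at least one of the edges $0\leftrightarrow i$, $0\leftrightarrow j$ is missing. The resulting identifying expressions (for $i$, for $j$, or for both) satisfy the equation of $i\leftrightarrow j$: substituting all of them, with an arbitrary element of $K$ for an unknown that has none, solves the equation. Moreover, at least one of the following two statements holds: $0\leftrightarrow i$ is missing and the equation with $x=\sigma_{0,i}/\sigma_{0,p}$ holds for every $y\in K$; or $0\leftrightarrow j$ is missing and the equation with $y=\sigma_{0,j}/\sigma_{0,q}$ holds for every $x\in K$. 3. Consequently, every connected component of the missing edge graph that contains a rank-$1$ edge also contains the root $0$. -/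

import Mathlib

/-- A mixed graph on the nodes `0, …, n`: directed edges `D` and bidirected edges `B`
(the latter are unordered pairs of distinct nodes). -/
structure MixedGraph (n : ℕ) where
  /-- the directed edges; `D.Adj i j` means `i → j` -/
  D : Digraph (Fin (n + 1))
  /-- the bidirected edges; `B.Adj i j` means `i ↔ j` -/
  B : SimpleGraph (Fin (n + 1))

/-- Names of the indeterminates `λ_{i,j}` and `ω_{i,j} = ω_{j,i}` (including `ω_{i,i}`). -/
inductive SEMParam (n : ℕ) : Type
  | lam (i j : Fin (n + 1)) : SEMParam n
  | om (e : Sym2 (Fin (n + 1))) : SEMParam n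

namespace MixedGraph

variable {n : ℕ} (M : MixedGraph n)

/-- `(V, D)` is a directed tree with root `0`: no edge enters the root, every other node has
exactly one parent, and every node is reachable from the root along directed edges. -/
structure IsTreeShaped : Prop where
  no_parent_root : ∀ p, ¬ M.D.Adj p 0
  existsUnique_parent : ∀ i, i ≠ 0 → ∃! p, M.D.Adj p i
  reachable : ∀ i, Relation.ReflTransGen M.D.Adj 0 i

/-- The missing edge graph `(V, B̄)`. -/
def missing : SimpleGraph (Fin (n + 1)) := M.Bᶜ

/-- Polynomials in the parameters. Indeterminates of absent edges never occur in the matrices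
below. -/
abbrev ParamRing (n : ℕ) : Type := MvPolynomial (SEMParam n) ℝ

/-- The rational function field in the parameters. -/
abbrev ParamField (n : ℕ) : Type := FractionRing (ParamRing n)

open Classical in
/-- The matrix `Λ`: entry `λ_{i,j}` if `i → j` is a directed edge, and `0` otherwise. -/
noncomputable def lamMatrix : Matrix (Fin (n + 1)) (Fin (n + 1)) (ParamRing n) :=
  Matrix.of fun i j => if M.D.Adj i j then MvPolynomial.X (SEMParam.lam i j) else 0

open Classical in
/-- The symmetric matrix `Ω`: entry `ω_{i,j}` if `i = j` or `i ↔ j` is a bidirected edge, and `0`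
otherwise. -/
noncomputable def omMatrix : Matrix (Fin (n + 1)) (Fin (n + 1)) (ParamRing n) :=
  Matrix.of fun i j => if i = j ∨ M.B.Adj i j then MvPolynomial.X (SEMParam.om s(i, j)) else 0

/-- The covariance matrix `Σ` of the variables `V_i = ∑ j, λ_{j,i} V_j + ε_i`, where `Ω` is the
covariance matrix of `ε`; that is, `Σ = (I - Λ)⁻ᵀ Ω (I - Λ)⁻¹`. -/
noncomputable def covMatrix : Matrix (Fin (n + 1)) (Fin (n + 1)) (ParamRing n) :=
  ((1 - M.lamMatrix)⁻¹).transpose * M.omMatrix * (1 - M.lamMatrix)⁻¹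

/-- For a tree-shaped graph `I - Λ` is invertible over the polynomial ring, so the inverse in
`covMatrix` is a genuine one. -/
theorem IsTreeShaped.isUnit_one_sub_lamMatrix {M : MixedGraph n} (hM : M.IsTreeShaped) :
    IsUnit (1 - M.lamMatrix) := by
  have key : ∀ v, ∃ k, ∀ i, (M.lamMatrix ^ k) i v = 0 := by
    intro v
    induction hM.reachable v with
    | refl =>
      refine ⟨1, fun i => ?_⟩
      simp [lamMatrix, hM.no_parent_root i]
    | @tail u v _ huv ih =>
      obtain ⟨k, hk⟩ := ih
      refine ⟨k + 1, fun i => ?_⟩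
      rw [pow_succ, Matrix.mul_apply]
      refine Finset.sum_eq_zero fun w _ => ?_
      by_cases hw : M.D.Adj w v
      · have hv : v ≠ 0 := by
          rintro rfl
          exact hM.no_parent_root _ huv
        rw [(hM.existsUnique_parent v hv).unique hw huv, hk, zero_mul]
      · simp [lamMatrix, hw]
  choose k hk using key
  refine IsNilpotent.isUnit_one_sub ⟨∑ v, k v, ?_⟩
  refine Matrix.ext fun i v => ?_
  have h : k v ≤ ∑ v, k v := Finset.single_le_sum (fun _ _ => Nat.zero_le _) (Finset.mem_univ v)
  obtain ⟨m, hm⟩ := Nat.exists_eq_add_of_le h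
  rw [hm, Nat.add_comm (k v) m, pow_add, Matrix.mul_apply]
  simp [hk]

/-- The covariance `σ_{i,j}`, as an element of the rational function field. -/
noncomputable def cov (i j : Fin (n + 1)) : ParamField n :=
  algebraMap (ParamRing n) (ParamField n) (M.covMatrix i j)

/-- The parameter `λ_{p,i}`, as an element of the rational function field. -/
noncomputable def lam (p i : Fin (n + 1)) : ParamField n :=
  algebraMap (ParamRing n) (ParamField n) (M.lamMatrix p i)

/-- The rank, over the rational function field, of the coefficient matrix of the pair `i, j`, where
`p` is the parent of `i` and `q` the parent of `j`. -/
noncomputable def edgeRank (p i q j : Fin (n + 1)) : ℕ :=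
  (!![M.cov p q, M.cov i q; M.cov p j, M.cov i j]).rank

/-- Left-hand side of the bilinear equation of the missing edge `i ↔ j` (with `p` the parent of `i`
and `q` the parent of `j`), the unknowns for `λ_{p,i}` and `λ_{q,j}` being `x` and `y`. -/
noncomputable def edgeEquation (p i q j : Fin (n + 1)) (x y : ParamField n) : ParamField n :=
  x * y * M.cov p q - x * M.cov p j - y * M.cov i q + M.cov i j

/-- The expression `σ_{0,i} / σ_{0,p}` that a missing edge `0 ↔ i` yields for `λ_{p,i}`. -/
noncomputable def rootExpr (p i : Fin (n + 1)) : ParamField n :=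
  M.cov 0 i / M.cov 0 p

end MixedGraph

/-! Let `N = Ω (I - Λ)⁻¹`, so that `N i k` is the covariance of `ε_i` with `V_k`: it equals `σ_{i,k}
- λ_{p,i} σ_{p,k}` if `p` is the parent of `i`, and `σ_{0,k}` if `i = 0`. Since `N (I - Λ) = Ω`, a
missing edge `i ↔ j` gives `N i j = N i q * λ_{q,j}`. For `i = 0` this identifies `λ_{q,j}`;
otherwise it says that the true parameters solve the edge equation. In rank 1 the determinant
vanishes, and `σ_{p,q}` times the left-hand side factors as `(x σ_{p,q} - σ_{i,q}) (y σ_{p,q} -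
σ_{p,j})`. The true parameters kill one factor, say the first, so `N i q = 0`. If `0 ↔ i` were in
`B`, a specialization would send `N i q` to `1`. Hence `0 ↔ i` is missing, its expression is the
true `λ_{p,i}`, and the factor vanishes whatever `y` is. -/

namespace MixedGraph

open Matrix

variable {n : ℕ} {M : MixedGraph n}

/-- The matrix `Ω (I - Λ)⁻¹` of covariances between the noise terms and the variables. -/
noncomputable def noiseCov (M : MixedGraph n) :
    Matrix (Fin (n + 1)) (Fin (n + 1)) (ParamRing n) :=
  M.omMatrix * (1 - M.lamMatrix)⁻¹

theorem covMatrix_eq : M.covMatrix = ((1 - M.lamMatrix)⁻¹)ᵀ * M.noiseCov :=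
  Matrix.mul_assoc _ _ _

theorem omMatrix_symm (i j : Fin (n + 1)) : M.omMatrix i j = M.omMatrix j i := by
  have h : (i = j ∨ M.B.Adj i j) ↔ (j = i ∨ M.B.Adj j i) := or_congr eq_comm (M.B.adj_comm i j)
  simp only [omMatrix, Matrix.of_apply, Sym2.eq_swap (a := i)]
  classical exact if_congr h rfl rfl

theorem covMatrix_symm (i j : Fin (n + 1)) : M.covMatrix i j = M.covMatrix j i := by
  have h : M.omMatrixᵀ = M.omMatrix := Matrix.ext fun a b => omMatrix_symm b a
  have h' : M.covMatrixᵀ = M.covMatrix := by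
    simp only [covMatrix, transpose_mul, transpose_transpose, h, Matrix.mul_assoc]
  exact (congrFun (congrFun h' i) j).symm

theorem cov_symm (i j : Fin (n + 1)) : M.cov i j = M.cov j i := by
  rw [cov, covMatrix_symm, cov]

theorem omMatrix_eq_zero {i j : Fin (n + 1)} (h : M.missing.Adj i j) : M.omMatrix i j = 0 := by
  rw [missing, SimpleGraph.compl_adj] at h
  simp [omMatrix, h.1, h.2]

/-- The evaluation with all `λ_{i,j}` equal to `1`, with `ω_{0,i} = 1` and with every other
`ω_{j,k}` equal to `0`. -/
noncomputable def evalRootNoise (i : Fin (n + 1)) : ParamRing n →+* ℝ := by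
  classical
  exact MvPolynomial.eval fun
    | .lam _ _ => 1
    | .om e => if e = s(i, 0) then 1 else 0

namespace IsTreeShaped

theorem ne_zero_of_adj (hM : M.IsTreeShaped) {p i : Fin (n + 1)} (h : M.D.Adj p i) : i ≠ 0 := by
  rintro rfl
  exact hM.no_parent_root p h

theorem lamMatrix_eq_zero (hM : M.IsTreeShaped) {p i a : Fin (n + 1)} (h : M.D.Adj p i)
    (ha : a ≠ p) : M.lamMatrix a i = 0 := by
  have : ¬ M.D.Adj a i := fun h' =>
    ha ((hM.existsUnique_parent i (hM.ne_zero_of_adj h)).unique h' h)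
  simp [lamMatrix, this]

theorem mul_one_sub_lamMatrix_apply (hM : M.IsTreeShaped) {p i : Fin (n + 1)} (h : M.D.Adj p i)
    (A : Matrix (Fin (n + 1)) (Fin (n + 1)) (ParamRing n)) (a : Fin (n + 1)) :
    (A * (1 - M.lamMatrix)) a i = A a i - A a p * M.lamMatrix p i := by
  rw [Matrix.mul_sub, Matrix.mul_one, Matrix.sub_apply, Matrix.mul_apply,
    Finset.sum_eq_single p (fun b _ hb => by rw [hM.lamMatrix_eq_zero h hb, mul_zero])
      (fun hp => absurd (Finset.mem_univ p) hp)]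

theorem mul_one_sub_lamMatrix_apply_zero (hM : M.IsTreeShaped)
    (A : Matrix (Fin (n + 1)) (Fin (n + 1)) (ParamRing n)) (a : Fin (n + 1)) :
    (A * (1 - M.lamMatrix)) a 0 = A a 0 := by
  rw [Matrix.mul_sub, Matrix.mul_one, Matrix.sub_apply, Matrix.mul_apply,
    Finset.sum_eq_zero (fun b _ => by simp [lamMatrix, hM.no_parent_root b]), sub_zero]

theorem inv_mul_one_sub_lamMatrix (hM : M.IsTreeShaped) :
    (1 - M.lamMatrix)⁻¹ * (1 - M.lamMatrix) = 1 :=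
  Matrix.nonsing_inv_mul _ ((Matrix.isUnit_iff_isUnit_det _).1 hM.isUnit_one_sub_lamMatrix)

theorem noiseCov_mul (hM : M.IsTreeShaped) : M.noiseCov * (1 - M.lamMatrix) = M.omMatrix := by
  rw [noiseCov, Matrix.mul_assoc, hM.inv_mul_one_sub_lamMatrix, Matrix.mul_one]

theorem noiseCov_eq (hM : M.IsTreeShaped) : M.noiseCov = (M.covMatrix * (1 - M.lamMatrix))ᵀ := by
  have h : M.covMatrixᵀ = M.covMatrix := Matrix.ext fun a b => covMatrix_symm b a
  rw [transpose_mul, h, covMatrix_eq, ← Matrix.mul_assoc, ← transpose_mul,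
    hM.inv_mul_one_sub_lamMatrix, transpose_one, Matrix.one_mul]

theorem noiseCov_zero_apply (hM : M.IsTreeShaped) (k : Fin (n + 1)) :
    M.noiseCov 0 k = M.covMatrix 0 k := by
  rw [hM.noiseCov_eq, transpose_apply, hM.mul_one_sub_lamMatrix_apply_zero, covMatrix_symm]

theorem noiseCov_apply (hM : M.IsTreeShaped) {p i : Fin (n + 1)} (h : M.D.Adj p i)
    (k : Fin (n + 1)) :
    M.noiseCov i k = M.covMatrix i k - M.lamMatrix p i * M.covMatrix p k := by
  rw [hM.noiseCov_eq, transpose_apply, hM.mul_one_sub_lamMatrix_apply h, covMatrix_symm k i,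
    covMatrix_symm k p, mul_comm]

theorem noiseCov_apply_eq_of_missing (hM : M.IsTreeShaped) {i j q : Fin (n + 1)}
    (hj : M.D.Adj q j) (h : M.missing.Adj i j) :
    M.noiseCov i j = M.noiseCov i q * M.lamMatrix q j := by
  rw [← sub_eq_zero, ← hM.mul_one_sub_lamMatrix_apply hj, hM.noiseCov_mul, omMatrix_eq_zero h]

/-- The entry is the product of the `λ`s along the path from the root to `v`, and all of them are
evaluated at `1`. -/
theorem evalRootNoise_inv (hM : M.IsTreeShaped) (i v : Fin (n + 1)) :
    evalRootNoise i ((1 - M.lamMatrix)⁻¹ 0 v) = 1 := by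
  have hinv := hM.inv_mul_one_sub_lamMatrix
  induction hM.reachable v with
  | refl =>
    have h := hM.mul_one_sub_lamMatrix_apply_zero (1 - M.lamMatrix)⁻¹ 0
    rw [hinv, Matrix.one_apply_eq] at h
    rw [← h, map_one]
  | @tail u v _ huv ih =>
    have h := hM.mul_one_sub_lamMatrix_apply huv (1 - M.lamMatrix)⁻¹ 0
    rw [hinv, Matrix.one_apply_ne (hM.ne_zero_of_adj huv).symm, eq_comm, sub_eq_zero] at h
    rw [h, map_mul, ih]
    simp [evalRootNoise, lamMatrix, huv]

/-- In row `i` of `Ω` only `ω_{i,0}` survives the evaluation, so only the path from the root to `q`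
contributes. -/
theorem evalRootNoise_noiseCov (hM : M.IsTreeShaped) {i : Fin (n + 1)}
    (hi : i = 0 ∨ M.B.Adj i 0) (q : Fin (n + 1)) :
    evalRootNoise i (M.noiseCov i q) = 1 := by
  rw [noiseCov, Matrix.mul_apply, map_sum, Finset.sum_eq_single 0]
  · rw [map_mul, hM.evalRootNoise_inv, mul_one]
    simp [omMatrix, evalRootNoise, hi]
  · intro b _ hb
    have h : evalRootNoise i (M.omMatrix i b) = 0 := by
      have : s(i, b) ≠ s(i, 0) := fun h => hb (Sym2.congr_right.1 h)
      simp only [omMatrix, Matrix.of_apply]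
      split_ifs
      · rw [evalRootNoise, MvPolynomial.eval_X]
        exact if_neg this
      · exact map_zero _
    rw [map_mul, h, zero_mul]
  · simp

theorem evalRootNoise_zero_noiseCov {i : Fin (n + 1)} (hi : i ≠ 0) (q : Fin (n + 1)) :
    evalRootNoise 0 (M.noiseCov i q) = 0 := by
  rw [noiseCov, Matrix.mul_apply, map_sum]
  refine Finset.sum_eq_zero fun b _ => ?_
  simp only [map_mul, omMatrix, Matrix.of_apply]
  split_ifs <;> simp [evalRootNoise, hi]

theorem noiseCov_ne_zero (hM : M.IsTreeShaped) {i : Fin (n + 1)}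
    (hi : i = 0 ∨ M.B.Adj i 0) (q : Fin (n + 1)) : M.noiseCov i q ≠ 0 := fun h => by
  simpa [h] using hM.evalRootNoise_noiseCov hi q

theorem cov_ne_zero (hM : M.IsTreeShaped) (p q : Fin (n + 1)) : M.cov p q ≠ 0 := by
  -- With `ω_{0,0} = 1` the only noise left and unit edge coefficients, every variable becomes
  -- `ε_0`, so all covariances become `1`.
  have h : evalRootNoise 0 (M.covMatrix p q) = 1 := by
    rw [covMatrix_eq, Matrix.mul_apply, map_sum, Finset.sum_eq_single 0]
    · rw [map_mul, transpose_apply, hM.evalRootNoise_inv, hM.evalRootNoise_noiseCov (Or.inl rfl),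
        mul_one]
    · intro b _ hb
      rw [map_mul, evalRootNoise_zero_noiseCov hb, mul_zero]
    · simp
  rw [cov, Ne, IsFractionRing.to_map_eq_zero_iff]
  intro h0
  simp [h0] at h

theorem lam_eq_rootExpr (hM : M.IsTreeShaped) {r k : Fin (n + 1)} (hk : M.D.Adj r k)
    (h : M.missing.Adj 0 k) : M.lam r k = M.rootExpr r k := by
  have := hM.noiseCov_apply_eq_of_missing hk h
  rw [hM.noiseCov_zero_apply, hM.noiseCov_zero_apply] at this
  rw [rootExpr, eq_div_iff (hM.cov_ne_zero 0 r), mul_comm, cov, cov, this, map_mul, lam]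

theorem algebraMap_noiseCov (hM : M.IsTreeShaped) {p i : Fin (n + 1)} (h : M.D.Adj p i)
    (k : Fin (n + 1)) :
    algebraMap (ParamRing n) (ParamField n) (M.noiseCov i k) =
      M.cov i k - M.lam p i * M.cov p k := by
  rw [hM.noiseCov_apply h, map_sub, map_mul]
  rfl

/-- The equation `hq` says that `N i q = 0`, which a bidirected edge `0 ↔ i` would exclude. -/
theorem missing_zero_of_lam_mul_cov_eq (hM : M.IsTreeShaped) {p i q : Fin (n + 1)}
    (h : M.D.Adj p i) (hq : M.lam p i * M.cov p q = M.cov i q) : M.missing.Adj 0 i := by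
  have hi := hM.ne_zero_of_adj h
  rw [missing, SimpleGraph.compl_adj]
  refine ⟨hi.symm, fun hB => hM.noiseCov_ne_zero (Or.inr hB.symm) q ?_⟩
  rw [← IsFractionRing.to_map_eq_zero_iff (K := ParamField n), hM.algebraMap_noiseCov h, hq,
    sub_self]

theorem edgeEquation_lam (hM : M.IsTreeShaped) {i j p q : Fin (n + 1)} (hi : M.D.Adj p i)
    (hj : M.D.Adj q j) (h : M.missing.Adj i j) :
    M.edgeEquation p i q j (M.lam p i) (M.lam q j) = 0 := by
  have := congrArg (algebraMap (ParamRing n) (ParamField n))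
    (hM.noiseCov_apply_eq_of_missing hj h)
  rw [map_mul, hM.algebraMap_noiseCov hi, hM.algebraMap_noiseCov hi] at this
  change _ = _ * M.lam q j at this
  rw [edgeEquation]
  linear_combination this

end IsTreeShaped

theorem cov_mul_cov_eq_of_edgeRank_eq_one {i j p q : Fin (n + 1)}
    (h : M.edgeRank p i q j = 1) : M.cov p q * M.cov i j = M.cov i q * M.cov p j := by
  by_contra hne
  have hu : IsUnit (!![M.cov p q, M.cov i q; M.cov p j, M.cov i j]) := by
    rw [Matrix.isUnit_iff_isUnit_det, Matrix.det_fin_two_of, isUnit_iff_ne_zero]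
    exact sub_ne_zero.2 hne
  have := Matrix.rank_of_isUnit _ hu
  rw [edgeRank] at h
  simp [h] at this

theorem edgeEquation_symm (p i q j : Fin (n + 1)) (x y : ParamField n) :
    M.edgeEquation p i q j x y = M.edgeEquation q j p i y x := by
  rw [edgeEquation, edgeEquation, cov_symm p q, cov_symm p j, cov_symm i q, cov_symm i j]
  ring

theorem cov_mul_edgeEquation {i j p q : Fin (n + 1)}
    (h : M.cov p q * M.cov i j = M.cov i q * M.cov p j) (x y : ParamField n) :
    M.cov p q * M.edgeEquation p i q j x y =
      (x * M.cov p q - M.cov i q) * (y * M.cov p q - M.cov p j) := by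
  rw [edgeEquation]
  linear_combination h

/-- On an edge with vanishing determinant, a factor that vanishes at the true parameter is
identified by the root. -/
theorem IsTreeShaped.missing_zero_and_edgeEquation (hM : M.IsTreeShaped) {i j p q : Fin (n + 1)}
    (hi : M.D.Adj p i) (h : M.cov p q * M.cov i j = M.cov i q * M.cov p j)
    (hq : M.lam p i * M.cov p q = M.cov i q) :
    M.missing.Adj 0 i ∧ ∀ y, M.edgeEquation p i q j (M.rootExpr p i) y = 0 := by
  have h0 := hM.missing_zero_of_lam_mul_cov_eq hi hq
  refine ⟨h0, fun y => (mul_eq_zero.1 ?_).resolve_left (hM.cov_ne_zero p q)⟩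
  rw [cov_mul_edgeEquation h, ← hM.lam_eq_rootExpr hi h0, hq, sub_self, zero_mul]

theorem IsTreeShaped.missing_zero_and_edgeEquation_or (hM : M.IsTreeShaped)
    {i j p q : Fin (n + 1)} (hi : M.D.Adj p i) (hj : M.D.Adj q j) (hij : M.missing.Adj i j)
    (hr : M.edgeRank p i q j = 1) :
    (M.missing.Adj 0 i ∧ ∀ y, M.edgeEquation p i q j (M.rootExpr p i) y = 0) ∨
      (M.missing.Adj 0 j ∧ ∀ x, M.edgeEquation p i q j x (M.rootExpr q j) = 0) := by
  have h := cov_mul_cov_eq_of_edgeRank_eq_one hr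
  have hprod := cov_mul_edgeEquation h (M.lam p i) (M.lam q j)
  rw [hM.edgeEquation_lam hi hj hij, mul_zero, eq_comm, mul_eq_zero, sub_eq_zero,
    sub_eq_zero] at hprod
  refine hprod.imp (hM.missing_zero_and_edgeEquation hi h) fun hy => ?_
  -- The second factor reduces to the first by exchanging `(p, i)` with `(q, j)`.
  simp only [edgeEquation_symm p i q j]
  refine hM.missing_zero_and_edgeEquation hj ?_ ?_
  · rw [cov_symm q p, cov_symm j i, cov_symm j p, cov_symm q i, h, mul_comm]
  · rw [cov_symm q p, cov_symm j p, hy]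

end MixedGraph

theorem mainTheorem3 {n : ℕ} (M : MixedGraph n) (hM : M.IsTreeShaped) :
    -- a missing edge `0 ↔ k` identifies the parameter of the edge `r → k` entering `k`
    (∀ k r : Fin (n + 1), M.D.Adj r k → M.missing.Adj 0 k →
      M.cov 0 r ≠ 0 ∧ M.lam r k = M.rootExpr r k) ∧
    -- rank-1 edges, where `p` is the parent of `i` and `q` the parent of `j`
    (∀ i j p q : Fin (n + 1), M.D.Adj p i → M.D.Adj q j → M.missing.Adj i j →
      M.edgeRank p i q j = 1 →
        -- at least one of `0 ↔ i` and `0 ↔ j` is missing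
        (M.missing.Adj 0 i ∨ M.missing.Adj 0 j) ∧
        -- plugging in all resulting expressions solves the equation of `i ↔ j`,
        -- whatever the value of a parameter for which there is none
        (∀ x y : MixedGraph.ParamField n,
          (M.missing.Adj 0 i → x = M.rootExpr p i) →
          (M.missing.Adj 0 j → y = M.rootExpr q j) →
          M.edgeEquation p i q j x y = 0) ∧
        -- one of the expressions alone already makes the equation vanish identically
        ((M.missing.Adj 0 i ∧
            ∀ y : MixedGraph.ParamField n, M.edgeEquation p i q j (M.rootExpr p i) y = 0) ∨
          (M.missing.Adj 0 j ∧
            ∀ x : MixedGraph.ParamField n, M.edgeEquation p i q j x (M.rootExpr q j) = 0))) ∧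
    -- a connected component of the missing edge graph with a rank-1 edge contains the root
    (∀ C : M.missing.ConnectedComponent,
      (∃ i j p q : Fin (n + 1), i ∈ C.supp ∧ j ∈ C.supp ∧ M.D.Adj p i ∧ M.D.Adj q j ∧
        M.missing.Adj i j ∧ M.edgeRank p i q j = 1) →
      (0 : Fin (n + 1)) ∈ C.supp) := by
  have key := fun (i j p q : Fin (n + 1)) (hi : M.D.Adj p i) (hj : M.D.Adj q j)
    (hij : M.missing.Adj i j) (hr : M.edgeRank p i q j = 1) =>
      hM.missing_zero_and_edgeEquation_or hi hj hij hr
  refine ⟨fun k r hk h => ⟨hM.cov_ne_zero 0 r, hM.lam_eq_rootExpr hk h⟩,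
    fun i j p q hi hj hij hr => ⟨?_, fun x y hx hy => ?_, key i j p q hi hj hij hr⟩, ?_⟩
  · exact (key i j p q hi hj hij hr).imp And.left And.left
  · rcases key i j p q hi hj hij hr with ⟨h0, h⟩ | ⟨h0, h⟩
    · rw [hx h0, h]
    · rw [hy h0, h]
  · rintro C ⟨i, j, p, q, hiC, hjC, hi, hj, hij, hr⟩
    rcases key i j p q hi hj hij hr with ⟨h0, -⟩ | ⟨h0, -⟩
    · exact C.mem_supp_of_adj_mem_supp hiC h0.symm
    · exact C.mem_supp_of_adj_mem_supp hjC h0.symm
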